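/- Let $\mathbb{P}_m$ be the set of $m\times m$ complex positive definite Hermitian matrices, with the Wasserstein distance $$d(A,B)=\Big[\operatorname{tr}\Big(\frac{A+B}{2}\Big)-\operatorname{tr}\,(A^{1/2}BA^{1/2})^{1/2}\Big]^{1/2},$$ and let $\Delta_n$ be the set of all $w=(w_1,\dots,w_n)\in\mathbb{R}^n$ with all $w_i>0$ and $\sum_i w_i=1$. For $\omega=(w_1,\dots,w_n)\in\Delta_n$ and $\mathbb{A}=(A_1,\dots,A_n)\in\mathbb{P}_m^n$, the Wasserstein mean $\Omega(\omega;\mathbb{A})$ is the unique minimizer over $X\in\mathbb{P}_m$ of $\sum_{j=1}^n w_j\,d(X,A_j)^2$. Let $A\otimes B$ denote the Kronecker product of matrices. Let $\mathbb{A}=(A_1,\dots,A_n),\ \mathbb{B}=(B_1,\dots,B_n)\in\mathbb{P}_m^n$ and let $\omega=(w_1,\dots,w_n),\ \mu=(\mu_1,\dots,\mu_n)\in\Delta_n$. Put $$\omega\otimes\mu:=(w_1\mu_1,\dots,w_1\mu_n,\ \dots,\ w_n\mu_1,\dots,w_n\mu_n).$$ Then $\omega\otimes\mu\in\Delta_{n^2}$,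 the three Wasserstein means below exist (that is, each of the three minimization problems has a unique minimizer), and $$\Omega(\omega;\mathbb{A})\otimes\Omega(\mu;\mathbb{B})=\Omega\big(\omega\otimes\mu;\ A_1\otimes B_1,\dots,A_1\otimes B_n,\ \dots,\ A_n\otimes B_1,\dots,A_n\otimes B_n\big).$$ -/

import Mathlib

open scoped ComplexOrder MatrixOrder Kronecker

noncomputable section

/-- The simplex `Δ` of all (strictly) positive probability vectors indexed by `ι`. -/
def positiveSimplex (ι : Type*) [Fintype ι] : Set (ι → ℝ) :=
  {w | (∀ i, 0 < w i) ∧ ∑ i, w i = 1}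

/-- The Wasserstein (Bures-Wasserstein) distance
`d(A, B) = [tr ((A + B) / 2) - tr (A^{1/2} B A^{1/2})^{1/2}]^{1/2}`. The square root of a positive
semidefinite matrix is `CFC.sqrt`; the traces of the matrices in question are real. -/
def wassersteinDist {m : Type*} [Fintype m] [DecidableEq m] (A B : Matrix m m ℂ) : ℝ :=
  Real.sqrt (((1 / 2 : ℂ) • (A + B)).trace.re
    - (CFC.sqrt (CFC.sqrt A * B * CFC.sqrt A)).trace.re)

/-- The objective function `X ↦ ∑ j, w_j d(X, A_j)²`. -/
def wassersteinObjective {ι m : Type*} [Fintype ι] [Fintype m] [DecidableEq m]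
    (w : ι → ℝ) (A : ι → Matrix m m ℂ) (X : Matrix m m ℂ) : ℝ :=
  ∑ j, w j * wassersteinDist X (A j) ^ 2

/-- `X` is the unique minimizer of the objective function over the positive definite matrices. -/
def IsWassersteinMean {ι m : Type*} [Fintype ι] [Fintype m] [DecidableEq m]
    (w : ι → ℝ) (A : ι → Matrix m m ℂ) (X : Matrix m m ℂ) : Prop :=
  X.PosDef ∧ ∀ Y : Matrix m m ℂ, Y.PosDef → Y ≠ X →
    wassersteinObjective w A X < wassersteinObjective w A Y

open Classical in
/-- The Wasserstein mean `Ω(w; A)`: the unique minimizer over the positive definite matrices of the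
objective function (and `0` if there were none). -/
def wassersteinMean {ι m : Type*} [Fintype ι] [Fintype m] [DecidableEq m]
    (w : ι → ℝ) (A : ι → Matrix m m ℂ) : Matrix m m ℂ :=
  if h : ∃ X, IsWassersteinMean w A X then h.choose else 0

/-- `w ⊗ v = (w_1 v_1, …, w_1 v_n, …, w_n v_1, …, w_n v_n)`: the entry at the (zero-based) position
`n * i + j` is `w_i v_j`. -/
def weightTensor {n : ℕ} (w v : Fin n → ℝ) : Fin (n * n) → ℝ :=
  fun k => w k.divNat * v k.modNat

/-- The tuple `(A_1 ⊗ B_1, …, A_1 ⊗ B_n, …, A_n ⊗ B_1, …, A_n ⊗ B_n)`: the entry at the (zero-based)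
position `n * i + j` is the Kronecker product `A_i ⊗ B_j`. -/
def tupleTensor {n : ℕ} {m : Type*} (A B : Fin n → Matrix m m ℂ) :
    Fin (n * n) → Matrix (m × m) (m × m) ℂ :=
  fun k => A k.divNat ⊗ₖ B k.modNat

end

/-! For positive definite `X` and `A`, the optimal transport map from `X` to `A` is the positive
definite solution `Z` of `Z * X * Z = A`, and the fidelity is `tr (X Z)`. If the maps `Z j` from `X`
to `A j` satisfy `∑ j, w j • Z j = 1`, then `X` is the Wasserstein mean
(`isWassersteinMean_of_riccati`), because `2 * fidelity Y A ≤ tr (Y Z) + tr (A Z⁻¹)`, with equality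
only if `Z * Y * Z = A`. This certificate is multiplicative: by the mixed-product rule `Z i ⊗ₖ V j`
carries `X ⊗ₖ Y` to `A i ⊗ₖ B j`, and the weighted average of these maps is `1 ⊗ₖ 1 = 1`. A
certificate always exists (`exists_riccati_sum_eq_one`). Replacing `X` by `T * X * T`, with `T` the
average of its transport maps, sends every positive definite matrix into a fixed compact set of
positive definite matrices, and can fail to lower the objective only if `T = 1`. A minimizer over
that set therefore has `T = 1`. -/

/-! ### Trace inequalities and the Riccati equation -/

section TraceInequalities

open Matrix

variable {m : Type*} [Fintype m] [DecidableEq m]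

/-- The square root of a positive definite matrix, as an existence statement. -/
theorem Matrix.PosDef.exists_mul_self_eq {X : Matrix m m ℂ} (hX : X.PosDef) :
    ∃ S : Matrix m m ℂ, S.PosDef ∧ S * S = X :=
  ⟨CFC.sqrt X, (IsStrictlyPositive.sqrt X hX.isStrictlyPositive).posDef,
    CFC.sqrt_mul_sqrt_self X hX.posSemidef.nonneg⟩

theorem Matrix.PosDef.conj_posDef {X Z : Matrix m m ℂ} (hX : X.PosDef) (hZ : Z.PosDef) :
    (Z * X * Z).PosDef := by
  have h := (Matrix.IsUnit.posDef_star_left_conjugate_iff (x := X) hZ.isUnit).2 hX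
  rwa [star_eq_conjTranspose, hZ.isHermitian.eq] at h

theorem Matrix.PosDef.inv_mul_self {Z : Matrix m m ℂ} (hZ : Z.PosDef) : Z⁻¹ * Z = 1 :=
  nonsing_inv_mul _ ((isUnit_iff_isUnit_det Z).1 hZ.isUnit)

theorem Matrix.PosDef.mul_inv_self {Z : Matrix m m ℂ} (hZ : Z.PosDef) : Z * Z⁻¹ = 1 :=
  mul_nonsing_inv _ ((isUnit_iff_isUnit_det Z).1 hZ.isUnit)

-- The right side is the squared Frobenius norm of `S * D * R`; all nonnegativity and equality cases
-- below come from it.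
omit [DecidableEq m] in
theorem trace_mul_conj_eq {S R D : Matrix m m ℂ} (hS : S.PosDef) (hR : R.PosDef) :
    (S * S * (D * (R * R) * Dᴴ)).trace = ((S * D * R) * (S * D * R)ᴴ).trace := by
  have h : (S * D * R) * (S * D * R)ᴴ = S * (D * (R * R) * Dᴴ * S) := by
    rw [conjTranspose_mul, conjTranspose_mul, hS.isHermitian.eq, hR.isHermitian.eq]
    noncomm_ring
  rw [h, trace_mul_comm S, trace_mul_comm (S * S)]
  congr 1
  noncomm_ring

theorem re_trace_mul_conj_nonneg {X Y : Matrix m m ℂ} (hX : X.PosDef) (hY : Y.PosDef)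
    (D : Matrix m m ℂ) : 0 ≤ (X * (D * Y * Dᴴ)).trace.re := by
  obtain ⟨S, hS, rfl⟩ := hX.exists_mul_self_eq
  obtain ⟨R, hR, rfl⟩ := hY.exists_mul_self_eq
  rw [trace_mul_conj_eq hS hR]
  exact (Complex.le_def.1 (posSemidef_self_mul_conjTranspose (S * D * R)).trace_nonneg).1

theorem eq_zero_of_re_trace_mul_conj_eq_zero {X Y D : Matrix m m ℂ} (hX : X.PosDef)
    (hY : Y.PosDef) (h : (X * (D * Y * Dᴴ)).trace.re = 0) : D = 0 := by
  obtain ⟨S, hS, rfl⟩ := hX.exists_mul_self_eq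
  obtain ⟨R, hR, rfl⟩ := hY.exists_mul_self_eq
  rw [trace_mul_conj_eq hS hR] at h
  have h0 : ((S * D * R) * (S * D * R)ᴴ).trace = 0 :=
    Complex.ext h (Complex.le_def.1
      (posSemidef_self_mul_conjTranspose (S * D * R)).trace_nonneg).2.symm
  rw [trace_mul_conjTranspose_self_eq_zero_iff] at h0
  calc D = (S⁻¹ * S) * D * (R * R⁻¹) := by rw [hS.inv_mul_self, hR.mul_inv_self]; simp
    _ = S⁻¹ * (S * D * R) * R⁻¹ := by noncomm_ring
    _ = 0 := by rw [h0]; simp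

-- With all factors Hermitian, the two traces are complex conjugates.
omit [DecidableEq m] in
theorem Matrix.IsHermitian.re_trace_mul_comm_conj {X S Z : Matrix m m ℂ} (hX : X.IsHermitian)
    (hS : S.IsHermitian) (hZ : Z.IsHermitian) :
    (X * (Z * S)).trace.re = (X * (S * Z)).trace.re := by
  have h : (X * (S * Z))ᴴ = Z * S * X := by
    rw [conjTranspose_mul, conjTranspose_mul, hX.eq, hS.eq, hZ.eq]
  have h2 := congrArg Complex.re (trace_conjTranspose (X * (S * Z)))
  rw [h, trace_mul_comm] at h2
  simpa using h2

/-- The defect in the variational inequality for `tr (X Z₀)`. -/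
theorem re_trace_variational_defect {X Z Z₀ : Matrix m m ℂ} (hZ : Z.PosDef) (hZ₀ : Z₀.PosDef) :
    (X * Z).trace.re + (Z₀ * X * Z₀ * Z⁻¹).trace.re - 2 * (X * Z₀).trace.re =
      (X * ((Z - Z₀) * Z⁻¹ * (Z - Z₀)ᴴ)).trace.re := by
  have h1 : (Z - Z₀)ᴴ = Z - Z₀ := (hZ.isHermitian.sub hZ₀.isHermitian).eq
  have h2 : (Z - Z₀) * Z⁻¹ * (Z - Z₀) =
      Z * Z⁻¹ * Z - Z₀ * (Z⁻¹ * Z) - (Z * Z⁻¹) * Z₀ + Z₀ * Z⁻¹ * Z₀ := by noncomm_ring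
  have h3 : (Z₀ * X * Z₀ * Z⁻¹).trace = (X * (Z₀ * Z⁻¹ * Z₀)).trace := by
    rw [show Z₀ * X * Z₀ * Z⁻¹ = Z₀ * (X * Z₀ * Z⁻¹) by noncomm_ring, trace_mul_comm]
    congr 1
    noncomm_ring
  rw [h1, h2, hZ.inv_mul_self, hZ.mul_inv_self, h3]
  simp only [one_mul, mul_one, mul_add, mul_sub, trace_add, trace_sub, Complex.add_re,
    Complex.sub_re]
  ring

theorem two_mul_re_trace_mul_le {X Z Z₀ : Matrix m m ℂ} (hX : X.PosDef) (hZ : Z.PosDef)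
    (hZ₀ : Z₀.PosDef) :
    2 * (X * Z₀).trace.re ≤ (X * Z).trace.re + (Z₀ * X * Z₀ * Z⁻¹).trace.re := by
  have := re_trace_mul_conj_nonneg hX hZ.inv (Z - Z₀)
  rw [← re_trace_variational_defect hZ hZ₀] at this
  linarith

theorem eq_of_two_mul_re_trace_mul_eq {X Z Z₀ : Matrix m m ℂ} (hX : X.PosDef) (hZ : Z.PosDef)
    (hZ₀ : Z₀.PosDef)
    (h : 2 * (X * Z₀).trace.re = (X * Z).trace.re + (Z₀ * X * Z₀ * Z⁻¹).trace.re) : Z = Z₀ := by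
  refine sub_eq_zero.1 (eq_zero_of_re_trace_mul_conj_eq_zero hX hZ.inv ?_)
  rw [← re_trace_variational_defect hZ hZ₀]
  linarith

/-- The positive definite solution `Z` of the Riccati equation `Z * X * Z = A` is unique. -/
theorem riccati_unique {X Z Z₀ : Matrix m m ℂ} (hX : X.PosDef) (hZ : Z.PosDef)
    (hZ₀ : Z₀.PosDef) (h : Z * X * Z = Z₀ * X * Z₀) : Z = Z₀ := by
  have key : ∀ {Z Z₀ : Matrix m m ℂ}, Z.PosDef → Z * X * Z = Z₀ * X * Z₀ →
      (Z₀ * X * Z₀ * Z⁻¹).trace.re = (X * Z).trace.re := by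
    intro Z Z₀ hZ h
    rw [← h, mul_assoc _ Z, hZ.mul_inv_self, mul_one, trace_mul_comm]
  -- By `key`, these say `tr (X Z₀) ≤ tr (X Z)` and the reverse, so the equality case applies.
  have h1 := two_mul_re_trace_mul_le hX hZ hZ₀
  have h2 := two_mul_re_trace_mul_le hX hZ₀ hZ
  have e1 := key hZ h
  have e2 := key hZ₀ h.symm
  exact eq_of_two_mul_re_trace_mul_eq hX hZ hZ₀ (by linarith)

end TraceInequalities

/-! ### Fidelity and its variational bounds -/

section Fidelity

open Matrix

variable {m : Type*} [Fintype m] [DecidableEq m]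

/-- The fidelity `tr (A^{1/2} B A^{1/2})^{1/2}`. -/
noncomputable def fidelity (A B : Matrix m m ℂ) : ℝ :=
  (CFC.sqrt (CFC.sqrt A * B * CFC.sqrt A)).trace.re

theorem exists_riccati_fidelity {X A : Matrix m m ℂ} (hX : X.PosDef) (hA : A.PosDef) :
    ∃ Z : Matrix m m ℂ, Z.PosDef ∧ Z * X * Z = A ∧ fidelity X A = (X * Z).trace.re := by
  have hS : (CFC.sqrt X).PosDef := (IsStrictlyPositive.sqrt X hX.isStrictlyPositive).posDef
  have hSS : CFC.sqrt X * CFC.sqrt X = X := CFC.sqrt_mul_sqrt_self X hX.posSemidef.nonneg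
  unfold fidelity
  set S := CFC.sqrt X
  have hP : (S * A * S).PosDef := hA.conj_posDef hS
  have hR : (CFC.sqrt (S * A * S)).PosDef :=
    (IsStrictlyPositive.sqrt _ hP.isStrictlyPositive).posDef
  have hRR : CFC.sqrt (S * A * S) * CFC.sqrt (S * A * S) = S * A * S :=
    CFC.sqrt_mul_sqrt_self _ hP.posSemidef.nonneg
  set R := CFC.sqrt (S * A * S)
  -- The optimal transport map `X^{-1/2} (X^{1/2} A X^{1/2})^{1/2} X^{-1/2}`.
  refine ⟨S⁻¹ * R * S⁻¹, hR.conj_posDef hS.inv, ?_, ?_⟩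
  · calc S⁻¹ * R * S⁻¹ * X * (S⁻¹ * R * S⁻¹)
        = S⁻¹ * R * (S⁻¹ * S) * (S * S⁻¹) * R * S⁻¹ := by rw [← hSS]; noncomm_ring
      _ = S⁻¹ * (R * R) * S⁻¹ := by rw [hS.inv_mul_self, hS.mul_inv_self]; noncomm_ring
      _ = (S⁻¹ * S) * A * (S * S⁻¹) := by rw [hRR]; noncomm_ring
      _ = A := by rw [hS.inv_mul_self, hS.mul_inv_self]; noncomm_ring
  · have : X * (S⁻¹ * R * S⁻¹) = S * (S * S⁻¹) * (R * S⁻¹) := by rw [← hSS]; noncomm_ring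
    rw [this, hS.mul_inv_self, mul_one, trace_mul_comm, mul_assoc, hS.inv_mul_self, mul_one]

theorem fidelity_eq_of_riccati {X A Z : Matrix m m ℂ} (hX : X.PosDef) (hZ : Z.PosDef)
    (h : Z * X * Z = A) : fidelity X A = (X * Z).trace.re := by
  obtain ⟨Z₀, hZ₀, h₀, hf⟩ := exists_riccati_fidelity hX (h ▸ hX.conj_posDef hZ : A.PosDef)
  rw [hf, riccati_unique hX hZ hZ₀ (h.trans h₀.symm)]

/-- For fixed `Z` the bound is affine in `X`, which gives both global optimality and lower
semicontinuity of the objective. -/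
theorem two_mul_fidelity_le {X A Z : Matrix m m ℂ} (hX : X.PosDef) (hA : A.PosDef)
    (hZ : Z.PosDef) :
    2 * fidelity X A ≤ (X * Z).trace.re + (A * Z⁻¹).trace.re := by
  obtain ⟨Z₀, hZ₀, rfl, hf⟩ := exists_riccati_fidelity hX hA
  rw [hf]
  exact two_mul_re_trace_mul_le hX hZ hZ₀

theorem riccati_of_two_mul_fidelity_eq {X A Z : Matrix m m ℂ} (hX : X.PosDef) (hA : A.PosDef)
    (hZ : Z.PosDef) (h : 2 * fidelity X A = (X * Z).trace.re + (A * Z⁻¹).trace.re) :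
    Z * X * Z = A := by
  obtain ⟨Z₀, hZ₀, rfl, hf⟩ := exists_riccati_fidelity hX hA
  rw [hf] at h
  rw [eq_of_two_mul_re_trace_mul_eq hX hZ hZ₀ h]

/-- The coupling `S * X * Z` of `S * X * S` and `Z * X * Z` bounds the fidelity from below. -/
theorem re_trace_coupling_le_fidelity {X S Z : Matrix m m ℂ} (hX : X.PosDef) (hS : S.PosDef)
    (hZ : Z.PosDef) : (X * (S * Z)).trace.re ≤ fidelity (S * X * S) (Z * X * Z) := by
  obtain ⟨V, hV, hVe, hf⟩ := exists_riccati_fidelity (hX.conj_posDef hS) (hX.conj_posDef hZ)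
  -- In the expansion both square terms equal the fidelity `tr (S X S V)`, and the cross terms give
  -- twice the coupling trace.
  have key := re_trace_mul_conj_nonneg hX hV (S - Z * V⁻¹)
  have h1 : (S - Z * V⁻¹)ᴴ = S - V⁻¹ * Z := by
    rw [conjTranspose_sub, conjTranspose_mul, hS.isHermitian.eq, hZ.isHermitian.eq,
      hV.inv.isHermitian.eq]
  have h2 : (S - Z * V⁻¹) * V * (S - V⁻¹ * Z) =
      S * V * S - S * (V * V⁻¹) * Z - Z * (V⁻¹ * V) * S + Z * (V⁻¹ * V) * V⁻¹ * Z := by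
    noncomm_ring
  have h3 : (X * (S * V * S)).trace = (S * X * S * V).trace := by
    rw [show X * (S * V * S) = (X * S * V) * S by noncomm_ring, trace_mul_comm]
    congr 1
    noncomm_ring
  have h4 : (X * (Z * V⁻¹ * Z)).trace = (S * X * S * V).trace := by
    rw [show X * (Z * V⁻¹ * Z) = (X * Z * V⁻¹) * Z by noncomm_ring, trace_mul_comm,
      show Z * (X * Z * V⁻¹) = (Z * X * Z) * V⁻¹ by noncomm_ring, ← hVe, mul_assoc _ V,
      hV.mul_inv_self, mul_one, trace_mul_comm]
  rw [h1, h2, hV.mul_inv_self, hV.inv_mul_self] at key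
  simp only [mul_one, mul_add, mul_sub, trace_add, trace_sub, Complex.add_re,
    Complex.sub_re, h3, h4] at key
  rw [hX.isHermitian.re_trace_mul_comm_conj hS.isHermitian hZ.isHermitian, ← hf] at key
  linarith

theorem wassersteinDist_sq {X A : Matrix m m ℂ} (hX : X.PosDef) (hA : A.PosDef) :
    wassersteinDist X A ^ 2 = (X.trace.re + A.trace.re) / 2 - fidelity X A := by
  have h : ((1 / 2 : ℂ) • (X + A)).trace.re = (X.trace.re + A.trace.re) / 2 := by
    rw [trace_smul, trace_add, smul_eq_mul,
      show (1 / 2 : ℂ) = ((1 / 2 : ℝ) : ℂ) by norm_num, Complex.re_ofReal_mul, Complex.add_re]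
    ring
  -- Taking `Z = 1` shows that the radicand is nonnegative, so `Real.sqrt` does not truncate.
  have h2 := two_mul_fidelity_le hX hA PosDef.one
  rw [inv_one, mul_one, mul_one] at h2
  change Real.sqrt (((1 / 2 : ℂ) • (X + A)).trace.re - fidelity X A) ^ 2 = _
  rw [h, Real.sq_sqrt (by linarith)]

end Fidelity
-- Determinant and trace bounds, compactness
section DetTrace

open Matrix

variable {m : Type*} [Fintype m]

theorem Matrix.PosSemidef.one_le_det_one_add [DecidableEq m] {R : Matrix m m ℂ}
    (hR : R.PosSemidef) : 1 ≤ (1 + R).det := by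
  have h1 : (1 + R).PosDef := PosDef.one.add_posSemidef hR
  have h2 : ∀ i, 1 ≤ h1.isHermitian.eigenvalues i := by
    intro i
    have hv := h1.isHermitian.mulVec_eigenvectorBasis i
    set x : m → ℂ := WithLp.ofLp (h1.isHermitian.eigenvectorBasis i)
    have hx : star x ⬝ᵥ x = 1 := by
      have := h1.isHermitian.eigenvectorBasis.inner_eq_one i
      rwa [EuclideanSpace.inner_eq_star_dotProduct, dotProduct_comm] at this
    have h3 := hR.dotProduct_mulVec_nonneg x
    have h4 : star x ⬝ᵥ ((1 + R) *ᵥ x) = 1 + star x ⬝ᵥ (R *ᵥ x) := by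
      rw [add_mulVec, one_mulVec, dotProduct_add, hx]
    rw [hv, dotProduct_smul, hx] at h4
    have h5 := congrArg Complex.re h4
    have h6 := (Complex.le_def.1 h3).1
    simp at h5 h6
    linarith
  rw [h1.isHermitian.det_eq_prod_eigenvalues]
  have h3 : (1 : ℝ) ≤ ∏ i, h1.isHermitian.eigenvalues i :=
    Finset.prod_const_one.symm.trans_le
      (Finset.prod_le_prod (fun _ _ => zero_le_one) fun i _ => h2 i)
  calc (1 : ℂ) = ((1 : ℝ) : ℂ) := by simp
    _ ≤ ((∏ i, h1.isHermitian.eigenvalues i : ℝ) : ℂ) := by exact_mod_cast h3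
    _ = _ := by simp

/-- Conjugation by `P^{-1/2}` reduces to the case `P = 1`. -/
theorem Matrix.PosDef.det_le_det_add [DecidableEq m] {P Q : Matrix m m ℂ} (hP : P.PosDef)
    (hQ : Q.PosSemidef) : P.det ≤ (P + Q).det := by
  obtain ⟨S, hS, rfl⟩ := hP.exists_mul_self_eq
  have hR : (S⁻¹ * Q * S⁻¹).PosSemidef := by
    have := hQ.conjTranspose_mul_mul_same S⁻¹
    rwa [hS.inv.isHermitian.eq] at this
  have h : S * S + Q = S * (1 + S⁻¹ * Q * S⁻¹) * S := by
    calc S * S + Q = S * S + (S * S⁻¹) * Q * (S⁻¹ * S) := by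
          rw [hS.inv_mul_self, hS.mul_inv_self]; simp
      _ = _ := by noncomm_ring
  have h1 : (0 : ℂ) ≤ S.det * S.det := mul_nonneg hS.det_pos.le hS.det_pos.le
  calc (S * S).det = S.det * S.det * 1 := by rw [det_mul, mul_one]
    _ ≤ S.det * S.det * (1 + S⁻¹ * Q * S⁻¹).det :=
      mul_le_mul_of_nonneg_left hR.one_le_det_one_add h1
    _ = _ := by rw [h, det_mul, det_mul]; ring

/-- Nonnegativity of the two-by-two principal minors bounds `‖X i j‖ ^ 2` by a product of diagonal
entries. -/
theorem Matrix.PosSemidef.norm_apply_le_re_trace {X : Matrix m m ℂ} (hX : X.PosSemidef)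
    (i j : m) : ‖X i j‖ ≤ X.trace.re := by
  have hd : ∀ k, 0 ≤ (X k k).re := fun k => (Complex.le_def.1 hX.diag_nonneg).1
  have hk : ∀ k, (X k k).re ≤ X.trace.re := by
    intro k
    rw [trace, Complex.re_sum]
    exact Finset.single_le_sum (f := fun k => (X k k).re) (fun k _ => hd k) (Finset.mem_univ k)
  have h0 : 0 ≤ X.trace.re := (hd i).trans (hk i)
  have h := (Complex.le_def.1 (hX.submatrix ![i, j]).det_nonneg).1
  have hi : ∀ k, (X k k).im = 0 := fun k => (Complex.le_def.1 hX.diag_nonneg).2.symm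
  have hji : X j i = star (X i j) := (hX.isHermitian.apply j i).symm
  have hsq : ‖X i j‖ ^ 2 ≤ (X i i).re * (X j j).re := by
    rw [Complex.sq_norm, Complex.normSq_apply]
    rw [det_fin_two] at h
    simp [hji, hi] at h
    linarith
  have : ‖X i j‖ ^ 2 ≤ X.trace.re ^ 2 := by
    nlinarith [mul_le_mul (hk i) (hk j) (hd j) h0]
  exact (sq_le_sq₀ (norm_nonneg _) h0).1 this

theorem isClosed_setOf_posSemidef : IsClosed {X : Matrix m m ℂ | X.PosSemidef} := by
  simp only [posSemidef_iff_dotProduct_mulVec, IsHermitian, Set.ofPred_and, Set.ofPred_forall]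
  refine (isClosed_eq (by fun_prop) continuous_id).inter (isClosed_iInter fun x => ?_)
  exact isClosed_le continuous_const (by fun_prop)

/-- The trace bound controls every entry. When `0 < d`, the determinant bound keeps the set away
from singular matrices. -/
theorem isCompact_posSemidef_det_trace [DecidableEq m] (d : ℂ) (c : ℝ) :
    IsCompact {X : Matrix m m ℂ | X.PosSemidef ∧ d ≤ X.det ∧ X.trace.re ≤ c} := by
  have hK : IsCompact (Set.univ.pi fun _ : m => Set.univ.pi fun _ : m =>
      Metric.closedBall (0 : ℂ) c) :=
    isCompact_univ_pi fun _ => isCompact_univ_pi fun _ => isCompact_closedBall _ _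
  refine hK.of_isClosed_subset ?_ ?_
  · refine isClosed_setOf_posSemidef.inter (IsClosed.inter ?_ ?_)
    · exact isClosed_le continuous_const (Continuous.matrix_det continuous_id)
    · exact isClosed_le (Complex.continuous_re.comp (Continuous.matrix_trace continuous_id))
        continuous_const
  · rintro X ⟨hX, -, hc⟩ i - j -
    simpa using (hX.norm_apply_le_re_trace i j).trans hc

end DetTrace

/-! ### The optimality certificate and its existence -/

section Mean

open Matrix

variable {ι m : Type*} [Fintype ι] [Fintype m] [DecidableEq m]

theorem re_trace_sum_smul (w : ι → ℝ) (X : Matrix m m ℂ) (Z : ι → Matrix m m ℂ) :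
    (X * ∑ j, w j • Z j).trace.re = ∑ j, w j * (X * Z j).trace.re := by
  rw [Finset.mul_sum, trace_sum, Complex.re_sum]
  simp [trace_smul]

theorem wassersteinObjective_eq {w : ι → ℝ} (hw : w ∈ positiveSimplex ι)
    {A : ι → Matrix m m ℂ} (hA : ∀ j, (A j).PosDef) {X : Matrix m m ℂ} (hX : X.PosDef) :
    wassersteinObjective w A X =
      (X.trace.re + ∑ j, w j * (A j).trace.re) / 2 - ∑ j, w j * fidelity X (A j) := by
  have h : ∀ j, w j * wassersteinDist X (A j) ^ 2 =
      w j * (X.trace.re / 2) + w j * (A j).trace.re / 2 - w j * fidelity X (A j) := by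
    intro j
    rw [wassersteinDist_sq hX (hA j)]
    ring
  unfold wassersteinObjective
  rw [Finset.sum_congr rfl fun j _ => h j, Finset.sum_sub_distrib, Finset.sum_add_distrib,
    ← Finset.sum_mul, hw.2, ← Finset.sum_div]
  ring

theorem wassersteinObjective_nonneg {w : ι → ℝ} (hw : w ∈ positiveSimplex ι)
    (A : ι → Matrix m m ℂ) (X : Matrix m m ℂ) : 0 ≤ wassersteinObjective w A X :=
  Finset.sum_nonneg fun j _ => mul_nonneg (hw.1 j).le (sq_nonneg _)

/-- A positive definite `X` whose optimal transport maps to the `A j` average to the identity is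
the Wasserstein mean. -/
theorem isWassersteinMean_of_riccati {w : ι → ℝ} (hw : w ∈ positiveSimplex ι)
    {A : ι → Matrix m m ℂ} {X : Matrix m m ℂ} (hX : X.PosDef) {Z : ι → Matrix m m ℂ}
    (hZ : ∀ j, (Z j).PosDef) (hZX : ∀ j, Z j * X * Z j = A j) (hsum : ∑ j, w j • Z j = 1) :
    IsWassersteinMean w A X := by
  have hA : ∀ j, (A j).PosDef := fun j => hZX j ▸ hX.conj_posDef (hZ j)
  refine ⟨hX, fun Y hY hne => ?_⟩
  -- This makes the dependence on `Y` cancel in the lower bound for the objective, leaving a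
  -- constant that `X` attains.
  have htr : ∀ Y : Matrix m m ℂ, Y.trace.re = ∑ j, w j * (Y * Z j).trace.re := fun Y => by
    rw [← re_trace_sum_smul, hsum, mul_one]
  have hXf : ∀ j, 2 * fidelity X (A j) = (X * Z j).trace.re + (A j * (Z j)⁻¹).trace.re := by
    intro j
    rw [fidelity_eq_of_riccati hX (hZ j) (hZX j), ← hZX j, mul_assoc _ (Z j),
      (hZ j).mul_inv_self, mul_one, trace_mul_comm (Z j)]
    ring
  have hYf : ∀ j, 2 * fidelity Y (A j) < (Y * Z j).trace.re + (A j * (Z j)⁻¹).trace.re := by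
    intro j
    -- Equality would give `Z j * Y * Z j = A j = Z j * X * Z j`, hence `Y = X`.
    refine (two_mul_fidelity_le hY (hA j) (hZ j)).lt_of_ne fun he => hne ?_
    have h := (riccati_of_two_mul_fidelity_eq hY (hA j) (hZ j) he).trans (hZX j).symm
    have hc : ∀ W : Matrix m m ℂ, (Z j)⁻¹ * (Z j * W * Z j) * (Z j)⁻¹ = W := fun W => by
      calc _ = ((Z j)⁻¹ * Z j) * W * (Z j * (Z j)⁻¹) := by noncomm_ring
        _ = W := by rw [(hZ j).inv_mul_self, (hZ j).mul_inv_self]; simp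
    rw [← hc Y, h, hc]
  have hne' : (Finset.univ : Finset ι).Nonempty := by
    by_contra h
    have := hw.2
    rw [Finset.not_nonempty_iff_eq_empty.1 h] at this
    simp at this
  have hlt : ∑ j, w j * (2 * fidelity Y (A j)) <
      ∑ j, w j * ((Y * Z j).trace.re + (A j * (Z j)⁻¹).trace.re) :=
    Finset.sum_lt_sum_of_nonempty hne' fun j _ => mul_lt_mul_of_pos_left (hYf j) (hw.1 j)
  have heq : ∑ j, w j * (2 * fidelity X (A j)) =
      ∑ j, w j * ((X * Z j).trace.re + (A j * (Z j)⁻¹).trace.re) :=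
    Finset.sum_congr rfl fun j _ => by rw [hXf j]
  simp only [mul_add, Finset.sum_add_distrib, ← htr, mul_left_comm _ (2 : ℝ),
    ← Finset.mul_sum] at hlt heq
  rw [wassersteinObjective_eq hw hA hX, wassersteinObjective_eq hw hA hY]
  linarith

omit [Fintype m] [DecidableEq m] in
theorem posDef_sum_smul {w : ι → ℝ} (hw : w ∈ positiveSimplex ι) {Z : ι → Matrix m m ℂ}
    (hZ : ∀ j, (Z j).PosDef) : (∑ j, w j • Z j).PosDef := by
  refine Matrix.posDef_sum ?_ fun j _ => (hZ j).smul (hw.1 j)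
  by_contra h
  have := hw.2
  rw [Finset.not_nonempty_iff_eq_empty.1 h] at this
  simp at this

/-- The objective at `S * X * S` is at most its value for the couplings `S * X * Z j`. -/
theorem wassersteinObjective_conj_le {w : ι → ℝ} (hw : w ∈ positiveSimplex ι)
    {A : ι → Matrix m m ℂ} {X S : Matrix m m ℂ} (hX : X.PosDef) (hS : S.PosDef)
    {Z : ι → Matrix m m ℂ} (hZ : ∀ j, (Z j).PosDef) (hZX : ∀ j, Z j * X * Z j = A j) :
    wassersteinObjective w A (S * X * S) ≤
      ((S * X * S).trace.re + ∑ j, w j * (A j).trace.re) / 2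
        - (X * (S * ∑ j, w j • Z j)).trace.re := by
  have hA : ∀ j, (A j).PosDef := fun j => hZX j ▸ hX.conj_posDef (hZ j)
  have h : (X * (S * ∑ j, w j • Z j)).trace.re ≤ ∑ j, w j * fidelity (S * X * S) (A j) := by
    rw [← mul_assoc, re_trace_sum_smul]
    refine Finset.sum_le_sum fun j _ => mul_le_mul_of_nonneg_left ?_ (hw.1 j).le
    rw [mul_assoc, ← hZX j]
    exact re_trace_coupling_le_fidelity hX hS (hZ j)
  rw [wassersteinObjective_eq hw hA (hX.conj_posDef hS)]
  linarith

omit [DecidableEq m] in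
theorem re_trace_conj_eq (X T : Matrix m m ℂ) :
    (X * (T * T)).trace.re = (T * X * T).trace.re := by
  rw [mul_assoc T, trace_mul_comm T, mul_assoc]

/-- For `S = T`, the average of the maps, the coupling bound on the objective is half of `∑ j, w j *
tr (A j) - tr (T X T)`, while the objective is nonnegative. -/
theorem re_trace_conj_le {w : ι → ℝ} (hw : w ∈ positiveSimplex ι)
    {A : ι → Matrix m m ℂ} {X : Matrix m m ℂ} (hX : X.PosDef)
    {Z : ι → Matrix m m ℂ} (hZ : ∀ j, (Z j).PosDef) (hZX : ∀ j, Z j * X * Z j = A j) :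
    ((∑ j, w j • Z j) * X * ∑ j, w j • Z j).trace.re ≤ ∑ j, w j * (A j).trace.re := by
  have h := wassersteinObjective_conj_le hw hX (posDef_sum_smul hw hZ) hZ hZX
  rw [re_trace_conj_eq] at h
  linarith [wassersteinObjective_nonneg hw A ((∑ j, w j • Z j) * X * ∑ j, w j • Z j)]

/-- If averaging the transport maps at `X` does not decrease the objective, they average to the
identity. -/
theorem sum_smul_eq_one_of_le {w : ι → ℝ} (hw : w ∈ positiveSimplex ι)
    {A : ι → Matrix m m ℂ} {X : Matrix m m ℂ} (hX : X.PosDef)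
    {Z : ι → Matrix m m ℂ} (hZ : ∀ j, (Z j).PosDef) (hZX : ∀ j, Z j * X * Z j = A j)
    (hle : wassersteinObjective w A X ≤
      wassersteinObjective w A ((∑ j, w j • Z j) * X * ∑ j, w j • Z j)) :
    ∑ j, w j • Z j = 1 := by
  have hA : ∀ j, (A j).PosDef := fun j => hZX j ▸ hX.conj_posDef (hZ j)
  have hT := posDef_sum_smul hw hZ
  have h1 := wassersteinObjective_conj_le hw hX hT hZ hZX
  have h2 : ∑ j, w j * fidelity X (A j) = (X * ∑ j, w j • Z j).trace.re := by
    rw [re_trace_sum_smul]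
    exact Finset.sum_congr rfl fun j _ => by rw [fidelity_eq_of_riccati hX (hZ j) (hZX j)]
  rw [wassersteinObjective_eq hw hA hX, h2] at hle
  set T := ∑ j, w j • Z j
  rw [re_trace_conj_eq] at h1
  -- `hle` and `h1` together say that this nonnegative trace `tr (X (T - 1)²)` is at most zero.
  have h3 := re_trace_mul_conj_nonneg hX PosDef.one (T - 1)
  have h4 : (X * ((T - 1) * 1 * (T - 1)ᴴ)).trace.re =
      (T * X * T).trace.re - 2 * (X * T).trace.re + X.trace.re := by
    rw [(hT.isHermitian.sub PosDef.one.isHermitian).eq, mul_one,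
      show X * ((T - 1) * (T - 1)) = X * (T * T) - X * T - X * T + X by noncomm_ring,
      trace_add, trace_sub, trace_sub, Complex.add_re, Complex.sub_re, Complex.sub_re,
      re_trace_conj_eq]
    ring
  exact sub_eq_zero.1 (eq_zero_of_re_trace_mul_conj_eq_zero hX PosDef.one (by linarith))

/-- The average dominates `w i • Z i`, so its determinant does too; `Z i * X * Z i = A i` then
eliminates `X`, making the bound uniform. -/
theorem det_conj_sum_smul_ge {w : ι → ℝ} (hw : w ∈ positiveSimplex ι)
    {A : ι → Matrix m m ℂ} {X : Matrix m m ℂ} (hX : X.PosDef)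
    {Z : ι → Matrix m m ℂ} (hZ : ∀ j, (Z j).PosDef) (hZX : ∀ j, Z j * X * Z j = A j) (i : ι) :
    ((w i : ℂ) ^ Fintype.card m) ^ 2 * (A i).det ≤
      ((∑ j, w j • Z j) * X * ∑ j, w j • Z j).det := by
  classical
  have hi : (w i • Z i).PosDef := (hZ i).smul (hw.1 i)
  have h : (w i • Z i).det ≤ (∑ j, w j • Z j).det := by
    rw [← Finset.add_sum_erase _ _ (Finset.mem_univ i)]
    exact hi.det_le_det_add
      (Matrix.posSemidef_sum _ fun j _ => ((hZ j).smul (hw.1 j)).posSemidef)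
  have h0 := hi.det_pos.le
  have hd : (w i • Z i).det = (w i : ℂ) ^ Fintype.card m * (Z i).det := by
    rw [← det_smul]
    congr 1
  calc ((w i : ℂ) ^ Fintype.card m) ^ 2 * (A i).det
      = X.det * ((w i • Z i).det * (w i • Z i).det) := by
        rw [← hZX i, det_mul, det_mul, hd]; ring
    _ ≤ X.det * ((∑ j, w j • Z j).det * (∑ j, w j • Z j).det) :=
        mul_le_mul_of_nonneg_left (mul_le_mul h h h0 (h0.trans h)) hX.det_pos.le
    _ = _ := by rw [det_mul, det_mul]; ring

/-- At each `X` the transport maps of `X` yield a continuous affine minorant `g` that touches the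
objective there. -/
theorem lowerSemicontinuousOn_wassersteinObjective {w : ι → ℝ} (hw : w ∈ positiveSimplex ι)
    {A : ι → Matrix m m ℂ} (hA : ∀ j, (A j).PosDef) :
    LowerSemicontinuousOn (wassersteinObjective w A) {X | X.PosDef} := by
  intro X hX y hy
  choose Z hZ hZX hf using fun j => exists_riccati_fidelity hX (hA j)
  let g : Matrix m m ℂ → ℝ := fun Y => (Y.trace.re + ∑ j, w j * (A j).trace.re) / 2 -
    ∑ j, w j * (((Y * Z j).trace.re + (A j * (Z j)⁻¹).trace.re) / 2)
  have hg : Continuous g := by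
    have h1 : Continuous fun Y : Matrix m m ℂ => Y.trace := Continuous.matrix_trace continuous_id
    have h2 : ∀ j, Continuous fun Y : Matrix m m ℂ => (Y * Z j).trace := fun j =>
      Continuous.matrix_trace (by fun_prop)
    fun_prop
  have hgX : g X = wassersteinObjective w A X := by
    rw [wassersteinObjective_eq hw hA hX]
    refine congrArg (_ - ·) (Finset.sum_congr rfl fun j _ => ?_)
    rw [hf j, ← hZX j, mul_assoc _ (Z j), (hZ j).mul_inv_self, mul_one, trace_mul_comm (Z j)]
    ring
  rw [← hgX] at hy
  filter_upwards [self_mem_nhdsWithin,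
    nhdsWithin_le_nhds (hg.continuousAt.eventually_const_lt hy)] with Y hY hyY
  refine hyY.trans_le ?_
  rw [wassersteinObjective_eq hw hA hY]
  refine sub_le_sub_left (Finset.sum_le_sum fun j _ =>
    mul_le_mul_of_nonneg_left ?_ (hw.1 j).le) _
  linarith [two_mul_fidelity_le hY (hA j) (hZ j)]

/-- There is a positive definite matrix whose transport maps to the `A j` average to the
identity. -/
theorem exists_riccati_sum_eq_one {w : ι → ℝ} (hw : w ∈ positiveSimplex ι)
    {A : ι → Matrix m m ℂ} (hA : ∀ j, (A j).PosDef) :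
    ∃ X : Matrix m m ℂ, X.PosDef ∧ ∃ Z : ι → Matrix m m ℂ, (∀ j, (Z j).PosDef) ∧
      (∀ j, Z j * X * Z j = A j) ∧ ∑ j, w j • Z j = 1 := by
  obtain ⟨i⟩ : Nonempty ι := by
    by_contra h
    have := hw.2
    rw [not_nonempty_iff] at h
    simp at this
  set d : ℂ := ((w i : ℂ) ^ Fintype.card m) ^ 2 * (A i).det
  set c : ℝ := ∑ j, w j * (A j).trace.re
  have hd : 0 < d := by
    have : (0 : ℂ) < w i := by exact_mod_cast hw.1 i
    exact mul_pos (pow_pos (pow_pos this _) _) (hA i).det_pos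
  set C : Set (Matrix m m ℂ) := {X | X.PosSemidef ∧ d ≤ X.det ∧ X.trace.re ≤ c}
  have hsub : C ⊆ {X | X.PosDef} := fun X hX =>
    hX.1.posDef_iff_det_ne_zero.2 (hd.trans_le hX.2.1).ne'
  choose! Z hZ hZX _ using fun (X : Matrix m m ℂ) (hX : X.PosDef) (j : ι) =>
    exists_riccati_fidelity hX (hA j)
  have hmaps : ∀ X : Matrix m m ℂ, X.PosDef →
      (∑ j, w j • Z X j) * X * (∑ j, w j • Z X j) ∈ C := fun X hX =>
    ⟨(hX.conj_posDef (posDef_sum_smul hw (hZ X hX))).posSemidef,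
      det_conj_sum_smul_ge hw hX (hZ X hX) (hZX X hX) i,
      re_trace_conj_le hw hX (hZ X hX) (hZX X hX)⟩
  -- Minimality over `C` suffices, since the averaged update of `X` lies in `C` again.
  obtain ⟨X, hXC, hmin⟩ := LowerSemicontinuousOn.exists_isMinOn ⟨_, hmaps 1 PosDef.one⟩
    (isCompact_posSemidef_det_trace d c)
    ((lowerSemicontinuousOn_wassersteinObjective hw hA).mono hsub)
  have hX : X.PosDef := hsub hXC
  exact ⟨X, hX, Z X, hZ X hX, hZX X hX,
    sum_smul_eq_one_of_le hw hX (hZ X hX) (hZX X hX) (hmin (hmaps X hX))⟩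

theorem IsWassersteinMean.unique {w : ι → ℝ} {A : ι → Matrix m m ℂ} {X Y : Matrix m m ℂ}
    (hX : IsWassersteinMean w A X) (hY : IsWassersteinMean w A Y) : X = Y := by
  by_contra h
  exact lt_asymm (hX.2 Y hY.1 (Ne.symm h)) (hY.2 X hX.1 h)

theorem IsWassersteinMean.wassersteinMean_eq {w : ι → ℝ} {A : ι → Matrix m m ℂ}
    {X : Matrix m m ℂ} (hX : IsWassersteinMean w A X) : wassersteinMean w A = X := by
  have h : ∃ X, IsWassersteinMean w A X := ⟨X, hX⟩
  rw [wassersteinMean, dif_pos h]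
  exact h.choose_spec.unique hX

end Mean

/-! ### Kronecker products of certificates -/

section Tensor

theorem sum_fin_mul {n : ℕ} {M : Type*} [AddCommMonoid M] (f : Fin n → Fin n → M) :
    ∑ k : Fin (n * n), f k.divNat k.modNat = ∑ i, ∑ j, f i j := by
  rw [← Fintype.sum_prod_type']
  exact Equiv.sum_comp finProdFinEquiv.symm fun p : Fin n × Fin n => f p.1 p.2

theorem weightTensor_mem_positiveSimplex {n : ℕ} {w v : Fin n → ℝ}
    (hw : w ∈ positiveSimplex (Fin n)) (hv : v ∈ positiveSimplex (Fin n)) :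
    weightTensor w v ∈ positiveSimplex (Fin (n * n)) := by
  refine ⟨fun k => mul_pos (hw.1 _) (hv.1 _), ?_⟩
  unfold weightTensor
  rw [sum_fin_mul fun i j => w i * v j, ← Finset.sum_mul_sum, hw.2, hv.2, one_mul]

theorem sum_smul_kronecker {n : ℕ} {m : Type*} (w v : Fin n → ℝ)
    (Z V : Fin n → Matrix m m ℂ) :
    ∑ k, weightTensor w v k • tupleTensor Z V k = (∑ i, w i • Z i) ⊗ₖ ∑ j, v j • V j := by
  unfold weightTensor tupleTensor
  rw [sum_fin_mul fun i j => (w i * v j) • (Z i ⊗ₖ V j)]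
  ext a b
  simp only [Matrix.sum_apply, Matrix.smul_apply, Matrix.kroneckerMap_apply, Finset.sum_mul_sum]
  refine Finset.sum_congr rfl fun i _ => Finset.sum_congr rfl fun j _ => ?_
  rw [smul_mul_smul_comm]

end Tensor

theorem theoremT (m n : ℕ) (A B : Fin n → Matrix (Fin m) (Fin m) ℂ)
    (hA : ∀ i, (A i).PosDef) (hB : ∀ i, (B i).PosDef)
    (w v : Fin n → ℝ) (hw : w ∈ positiveSimplex (Fin n)) (hv : v ∈ positiveSimplex (Fin n)) :
    weightTensor w v ∈ positiveSimplex (Fin (n * n)) ∧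
    IsWassersteinMean w A (wassersteinMean w A) ∧
    IsWassersteinMean v B (wassersteinMean v B) ∧
    IsWassersteinMean (weightTensor w v) (tupleTensor A B)
      (wassersteinMean (weightTensor w v) (tupleTensor A B)) ∧
    wassersteinMean w A ⊗ₖ wassersteinMean v B =
      wassersteinMean (weightTensor w v) (tupleTensor A B) := by

  obtain ⟨X, hX, Z, hZ, hZX, hZs⟩ := exists_riccati_sum_eq_one hw hA
  obtain ⟨Y, hY, V, hV, hVY, hVs⟩ := exists_riccati_sum_eq_one hv hB
  have hwv := weightTensor_mem_positiveSimplex hw hv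
  have h1 := isWassersteinMean_of_riccati hw hX hZ hZX hZs
  have h2 := isWassersteinMean_of_riccati hv hY hV hVY hVs
  have h3 : IsWassersteinMean (weightTensor w v) (tupleTensor A B) (X ⊗ₖ Y) := by
    refine isWassersteinMean_of_riccati hwv (hX.kronecker hY) (Z := tupleTensor Z V)
      (fun k => (hZ _).kronecker (hV _)) (fun k => ?_) ?_
    · simp only [tupleTensor]
      rw [← Matrix.mul_kronecker_mul, ← Matrix.mul_kronecker_mul, hZX, hVY]
    · rw [sum_smul_kronecker, hZs, hVs, Matrix.one_kronecker_one]
  rw [h1.wassersteinMean_eq, h2.wassersteinMean_eq, h3.wassersteinMean_eq]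
  exact ⟨hwv, h1, h2, h3, rfl⟩
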